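/- For finite-dimensional complex vector spaces $A,B,C$ and $T\in A\otimes B\otimes C$, let the rank $\mathrm R(T)$ be the least $r$ such that $T$ is a sum of $r$ simple tensors $x\otimes y\otimes z$, and let the border rank $\underline{\mathrm R}(T)$ be the least $r$ such that $T$ is a limit (in the Euclidean topology) of a sequence of tensors of rank at most $r$. The Kronecker product of $T\in A\otimes B\otimes C$ and $S\in A'\otimes B'\otimes C'$ is the tensor $T\boxtimes S\in (A\otimes A')\otimes(B\otimes B')\otimes(C\otimes C')$, bilinear in $(T,S)$, with $(a\otimes b\otimes c)\boxtimes(a'\otimes b'\otimes c')=(a\otimes a')\otimes(b\otimes b')\otimes(c\otimes c')$; put $T^{\boxtimes 3}=(T\boxtimes T)\boxtimes T$. For $q\ge 1$ the little Coppersmith–Winograd tensor is \[ T_{cw,q}=\sum_{j=1}^{q}\bigl(a_0\otimes b_j\otimes c_j+a_j\otimes b_0\otimes c_j+a_j\otimes b_j\otimes c_0\bigr)\in(\mathbb C^{q+1})^{\otimes 3}, \] where $(a_i)_{i=0}^q$, $(b_i)_{i=0}^q$, $(c_i)_{i=0}^q$ each denote the standard basis of $\mathbb C^{q+1}$. **Theorem.**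 For every integer $q\ge 5$, \[ \underline{\mathrm R}\bigl(T_{cw,q}^{\boxtimes 3}\bigr)=(q+2)^3 . \] -/

import Mathlib

open scoped TensorProduct

noncomputable section

section TensorRank

variable {A B C A' B' C' : Type*}
  [AddCommGroup A] [Module ℂ A] [AddCommGroup B] [Module ℂ B] [AddCommGroup C] [Module ℂ C]
  [AddCommGroup A'] [Module ℂ A'] [AddCommGroup B'] [Module ℂ B'] [AddCommGroup C'] [Module ℂ C']

/-- `T` is a sum of `r` simple tensors `x ⊗ y ⊗ z`. -/
def IsSumOfSimple (T : A ⊗[ℂ] (B ⊗[ℂ] C)) (r : ℕ) : Prop :=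
  ∃ (x : Fin r → A) (y : Fin r → B) (z : Fin r → C), T = ∑ l, x l ⊗ₜ[ℂ] (y l ⊗ₜ[ℂ] z l)

/-- The tensor rank `R(T)`: the least `r` such that `T` is a sum of `r` simple tensors. -/
def tensorRank (T : A ⊗[ℂ] (B ⊗[ℂ] C)) : ℕ :=
  sInf {r | IsSumOfSimple T r}

/-- `T` is the limit of a sequence of tensors of rank at most `r`. The limit is taken in the
module topology, which on a finite-dimensional complex vector space is the Euclidean topology. -/
def IsLimitOfRankLE (T : A ⊗[ℂ] (B ⊗[ℂ] C)) (r : ℕ) : Prop :=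
  ∃ u : ℕ → A ⊗[ℂ] (B ⊗[ℂ] C), (∀ n, tensorRank (u n) ≤ r) ∧
    Filter.Tendsto u Filter.atTop (@nhds _ (moduleTopology ℂ (A ⊗[ℂ] (B ⊗[ℂ] C))) T)

/-- The border rank: the least `r` such that `T` is a limit of tensors of rank at most `r`. -/
def borderRank (T : A ⊗[ℂ] (B ⊗[ℂ] C)) : ℕ :=
  sInf {r | IsLimitOfRankLE T r}

/-- Every tensor is a finite sum of simple tensors, so the minimum in `tensorRank` exists. -/
theorem exists_isSumOfSimple (T : A ⊗[ℂ] (B ⊗[ℂ] C)) : ∃ r, IsSumOfSimple T r := by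
  have hadd : ∀ S T : A ⊗[ℂ] (B ⊗[ℂ] C), (∃ r, IsSumOfSimple S r) → (∃ r, IsSumOfSimple T r) →
      ∃ r, IsSumOfSimple (S + T) r := by
    rintro S T ⟨r, x, y, z, rfl⟩ ⟨s, x', y', z', rfl⟩
    refine ⟨r + s, Fin.append x x', Fin.append y y', Fin.append z z', ?_⟩
    simp [Fin.sum_univ_add]
  have hzero : ∃ r, IsSumOfSimple (0 : A ⊗[ℂ] (B ⊗[ℂ] C)) r :=
    ⟨0, Fin.elim0, Fin.elim0, Fin.elim0, by simp⟩
  induction T using TensorProduct.induction_on with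
  | zero => exact hzero
  | add S T hS hT => exact hadd S T hS hT
  | tmul a w =>
    induction w using TensorProduct.induction_on with
    | zero => simpa using hzero
    | add v w hv hw => simpa [TensorProduct.tmul_add] using hadd _ _ hv hw
    | tmul b c => exact ⟨1, fun _ => a, fun _ => b, fun _ => c, by simp⟩

/-- The minimum in `borderRank` exists. -/
theorem exists_isLimitOfRankLE (T : A ⊗[ℂ] (B ⊗[ℂ] C)) : ∃ r, IsLimitOfRankLE T r :=
  ⟨tensorRank T, fun _ => T, fun _ => le_rfl,
    letI := moduleTopology ℂ (A ⊗[ℂ] (B ⊗[ℂ] C)); tendsto_const_nhds⟩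

/-- The Kronecker product `T ⊠ S` of two tensors of order three; it is bilinear and sends
`(a ⊗ b ⊗ c, a' ⊗ b' ⊗ c')` to `(a ⊗ a') ⊗ (b ⊗ b') ⊗ (c ⊗ c')`. -/
def kronecker (T : A ⊗[ℂ] (B ⊗[ℂ] C)) (S : A' ⊗[ℂ] (B' ⊗[ℂ] C')) :
    (A ⊗[ℂ] A') ⊗[ℂ] ((B ⊗[ℂ] B') ⊗[ℂ] (C ⊗[ℂ] C')) :=
  (TensorProduct.tensorTensorTensorComm ℂ B C B' C').toLinearMap.lTensor (A ⊗[ℂ] A')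
    (TensorProduct.tensorTensorTensorComm ℂ A (B ⊗[ℂ] C) A' (B' ⊗[ℂ] C') (T ⊗ₜ[ℂ] S))

theorem kronecker_tmul (a : A) (b : B) (c : C) (a' : A') (b' : B') (c' : C') :
    kronecker (a ⊗ₜ[ℂ] (b ⊗ₜ[ℂ] c)) (a' ⊗ₜ[ℂ] (b' ⊗ₜ[ℂ] c')) =
      (a ⊗ₜ[ℂ] a') ⊗ₜ[ℂ] ((b ⊗ₜ[ℂ] b') ⊗ₜ[ℂ] (c ⊗ₜ[ℂ] c')) := by
  simp [kronecker]

/-- The Kronecker cube `T^{⊠3} = (T ⊠ T) ⊠ T`. -/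
def kroneckerCube (T : A ⊗[ℂ] (B ⊗[ℂ] C)) :
    ((A ⊗[ℂ] A) ⊗[ℂ] A) ⊗[ℂ] (((B ⊗[ℂ] B) ⊗[ℂ] B) ⊗[ℂ] ((C ⊗[ℂ] C) ⊗[ℂ] C)) :=
  kronecker (kronecker T T) T

end TensorRank

/-- The standard basis vector `e_i` of `ℂ^{q+1}`, `0 ≤ i ≤ q`. -/
def stdVec (q : ℕ) (i : Fin (q + 1)) : Fin (q + 1) → ℂ := Pi.single i 1

/-- The little Coppersmith–Winograd tensor
`∑_{j=1}^q (a_0 ⊗ b_j ⊗ c_j + a_j ⊗ b_0 ⊗ c_j + a_j ⊗ b_j ⊗ c_0)` in `(ℂ^{q+1})^{⊗3}`. -/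
def littleCW (q : ℕ) :
    (Fin (q + 1) → ℂ) ⊗[ℂ] ((Fin (q + 1) → ℂ) ⊗[ℂ] (Fin (q + 1) → ℂ)) :=
  ∑ j : Fin q,
    (stdVec q 0 ⊗ₜ[ℂ] (stdVec q j.succ ⊗ₜ[ℂ] stdVec q j.succ)
      + stdVec q j.succ ⊗ₜ[ℂ] (stdVec q 0 ⊗ₜ[ℂ] stdVec q j.succ)
      + stdVec q j.succ ⊗ₜ[ℂ] (stdVec q j.succ ⊗ₜ[ℂ] stdVec q 0))

end

/-!
The tensor `littleCW q` is the trilinear form `(x, y, z) ↦ λ(xyz)` on the span of `1, x_1, …, x_q`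
in the Frobenius algebra with basis `1, x_1, …, x_q, s` and products `x_j ^ 2 = s`,
`x_i x_j = x_j s = s ^ 2 = 0` for `i ≠ j`, where `λ` is the coefficient of `s`. This algebra has
dimension `q + 2`, and the Kronecker cube comes in the same way from its third tensor power.

Lower bound: restrict the first argument of the cube to the span of the unit and four further
elements `f₀, f₁, f₂, f₃`. The Koszul flattening on `Λ²` of this five-dimensional space sends simple
tensors to matrices of rank at most `6`. Since the algebra is commutative, the flattening of the
cube factors as `L (H ⊗ S) Lᵀ`, where `H` pairs `Λ²` of the span of the `fᵢ` with itself and `S` is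
the Gram matrix of the trace form; the middle matrix is invertible of size `6 (q + 2) ^ 3`. The `fᵢ`
involve only six letters, so the equations for the kernel of `L` couple, in each position, these
letters with at most one further letter. Hence the injectivity of `L` is the same finite elimination
for every `q`.

Upper bound: `littleCW q` is a limit of tensors of rank `q + 2`, and border rank is
submultiplicative under the Kronecker product.
-/

open scoped Kronecker Matrix

section Rank

variable {m n m' n' K : Type*} [Fintype n] [Field K]

theorem rank_add_le_rank_add_rank [Finite m] (A B : Matrix m n K) :
    (A + B).rank ≤ A.rank + B.rank := by
  rw [Matrix.rank, Matrix.rank, Matrix.rank, Matrix.mulVecLin_add]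
  exact (Submodule.finrank_mono (LinearMap.range_add_le _ _)).trans
    (Submodule.finrank_add_le_finrank_add_finrank _ _)

theorem rank_sum_le_card_mul [Finite m] {ι : Type*} (s : Finset ι) (A : ι → Matrix m n K) {c : ℕ}
    (hA : ∀ i, (A i).rank ≤ c) : (∑ i ∈ s, A i).rank ≤ s.card * c := by
  classical
  induction s using Finset.induction_on with
  | empty => simp
  | insert i s hi ih =>
    rw [Finset.sum_insert hi, Finset.card_insert_of_notMem hi, add_one_mul, add_comm]
    exact (rank_add_le_rank_add_rank _ _).trans (add_le_add ih (hA i))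

theorem rank_fromBlocks_zero_zero_le [Finite m] [Finite m'] [Fintype n']
    (B : Matrix m n K) (C : Matrix m' n' K) :
    (Matrix.fromBlocks 0 B C 0).rank ≤ B.rank + C.rank := by
  classical
  have := Fintype.ofFinite m
  have := Fintype.ofFinite m'
  have h : Matrix.fromBlocks 0 B C 0 =
      (Matrix.fromRows 1 0 : Matrix (m ⊕ m') m K) * B *
          (Matrix.fromCols 0 1 : Matrix n (n' ⊕ n) K) +
        (Matrix.fromRows 0 1 : Matrix (m ⊕ m') m' K) * C *
          (Matrix.fromCols 1 0 : Matrix n' (n' ⊕ n) K) := by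
    simp only [Matrix.fromRows_mul, Matrix.mul_fromCols, Matrix.one_mul, Matrix.zero_mul,
      Matrix.mul_one, Matrix.mul_zero]
    ext (i | i) (j | j) <;> simp
  rw [h]
  exact (rank_add_le_rank_add_rank _ _).trans
    (add_le_add ((Matrix.rank_mul_le_left _ _).trans (Matrix.rank_mul_le_right _ _))
      ((Matrix.rank_mul_le_left _ _).trans (Matrix.rank_mul_le_right _ _)))

theorem rank_kronecker_vecMulVec_le [Finite m] [Finite m'] [Fintype n'] (A : Matrix m n K)
    (y : m' → K) (z : n' → K) : (A ⊗ₖ Matrix.vecMulVec y z).rank ≤ A.rank := by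
  classical
  have := Fintype.ofFinite m
  have h : A ⊗ₖ Matrix.vecMulVec y z =
      (Matrix.of fun i j => if i.1 = j then y i.2 else 0 : Matrix (m × m') m K) * A *
        (Matrix.of fun i j => if i = j.1 then z j.2 else 0 : Matrix n (n × n') K) := by
    ext ⟨i, k⟩ ⟨j, l⟩
    simp [Matrix.mul_apply, Matrix.vecMulVec_apply, mul_left_comm, mul_comm]
  rw [h]
  exact (Matrix.rank_mul_le_left _ _).trans (Matrix.rank_mul_le_right _ _)

theorem card_le_rank_mul_mul_transpose [Fintype m] [DecidableEq n] {L : Matrix m n K}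
    (hL : Function.Injective L.mulVec) {G : Matrix n n K} (hG : IsUnit G) :
    Fintype.card n ≤ (L * G * L.transpose).rank := by
  classical
  obtain ⟨g, hg⟩ := L.mulVecLin.exists_leftInverse_of_injective (LinearMap.ker_eq_bot.2 hL)
  have hP : LinearMap.toMatrix' g * L = 1 := by
    rw [← LinearMap.toMatrix'_id, ← hg, LinearMap.toMatrix'_comp, ← Matrix.toLin'_apply',
      LinearMap.toMatrix'_toLin']
  calc Fintype.card n = G.rank := (Matrix.rank_of_isUnit G hG).symm
    _ = (LinearMap.toMatrix' g *
        (L * G * L.transpose * (LinearMap.toMatrix' g).transpose)).rank := by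
      rw [Matrix.mul_assoc (L * G), ← Matrix.transpose_mul, hP, Matrix.transpose_one,
        Matrix.mul_one, ← Matrix.mul_assoc, hP, Matrix.one_mul]
    _ ≤ (L * G * L.transpose).rank :=
      (Matrix.rank_mul_le_right _ _).trans (Matrix.rank_mul_le_left _ _)

end Rank

section Koszul

variable {K : Type*} [Field K]

variable (K) in
/-- The Gram matrix of the pairing `Λ²K⁴ × Λ²K⁴ → Λ⁴K⁴` in the basis
`e₀₁, e₀₂, e₀₃, e₁₂, e₁₃, e₂₃`. -/
def hodgeMatrix : Matrix (Fin 6) (Fin 6) K :=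
  !![0, 0, 0, 0, 0, 1;
     0, 0, 0, 0, -1, 0;
     0, 0, 0, 1, 0, 0;
     0, 0, 1, 0, 0, 0;
     0, -1, 0, 0, 0, 0;
     1, 0, 0, 0, 0, 0]

/-- The matrix of `y ↦ v ∧ y : K⁴ → Λ²K⁴`, with `Λ²K⁴` in the basis
`e₀₁, e₀₂, e₀₃, e₁₂, e₁₃, e₂₃`. -/
def wedge : (Fin 4 → K) →ₗ[K] Matrix (Fin 6) (Fin 4) K where
  toFun v := !![-v 1, v 0, 0, 0;
                -v 2, 0, v 0, 0;
                -v 3, 0, 0, v 0;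
                0, -v 2, v 1, 0;
                0, -v 3, 0, v 1;
                0, 0, -v 3, v 2]
  map_add' v w := by
    ext i j
    fin_cases i <;> fin_cases j <;> simp [add_comm]
  map_smul' c v := by
    ext i j
    fin_cases i <;> fin_cases j <;> simp

theorem hodgeMatrix_mul_self : hodgeMatrix K * hodgeMatrix K = 1 := by
  ext i j
  fin_cases i <;> fin_cases j <;> simp [hodgeMatrix, Matrix.mul_apply, Fin.sum_univ_succ]

theorem wedge_mulVec_self (v : Fin 4 → K) : wedge v *ᵥ v = 0 := by
  ext i
  fin_cases i <;> simp [wedge, Matrix.mulVec, dotProduct, Fin.sum_univ_four] <;> ring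

theorem wedge_mulVec_antisymm (v w : Fin 4 → K) : wedge w *ᵥ v = -(wedge v *ᵥ w) := by
  refine eq_neg_of_add_eq_zero_left ?_
  simpa only [map_add, Matrix.add_mulVec, Matrix.mulVec_add, wedge_mulVec_self, zero_add, add_zero]
    using wedge_mulVec_self (v + w)

theorem wedge_transpose_mul_hodgeMatrix_mul_wedge_self (v : Fin 4 → K) :
    (wedge v)ᵀ * (hodgeMatrix K * wedge v) = 0 := by
  have hwedge : hodgeMatrix K * wedge v = !![0, 0, -v 3, v 2;
                                             0, v 3, 0, -v 1;
                                             0, -v 2, v 1, 0;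
                                             -v 3, 0, 0, v 0;
                                             v 2, 0, -v 0, 0;
                                             -v 1, v 0, 0, 0] := by
    ext i j
    fin_cases i <;> fin_cases j <;> simp [wedge, hodgeMatrix, Matrix.mul_apply, Fin.sum_univ_six]
  rw [hwedge]
  ext i j
  fin_cases i <;> fin_cases j <;>
    simp [wedge, Matrix.mul_apply, Fin.sum_univ_six] <;> ring

theorem rank_wedge_le (v : Fin 4 → K) : (wedge v).rank ≤ 3 := by
  obtain rfl | hv := eq_or_ne v 0
  · simp
  have hker : 1 ≤ Module.finrank K (LinearMap.ker (wedge v).mulVecLin) :=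
    Submodule.one_le_finrank_iff.2 fun h =>
      hv ((Submodule.mem_bot K).1 (h ▸ LinearMap.mem_ker.2 (wedge_mulVec_self v)))
  have h := LinearMap.finrank_range_add_finrank_ker (wedge v).mulVecLin
  rw [Module.finrank_fin_fun, ← Matrix.rank] at h
  omega

theorem wedge_transpose_mul_hodgeMatrix_mul_wedge_antisymm (v w : Fin 4 → K) :
    (wedge w)ᵀ * (hodgeMatrix K * wedge v) = -((wedge v)ᵀ * (hodgeMatrix K * wedge w)) := by
  refine eq_neg_of_add_eq_zero_left ?_
  simpa only [map_add, Matrix.transpose_add, Matrix.add_mul, Matrix.mul_add,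
    wedge_transpose_mul_hodgeMatrix_mul_wedge_self, zero_add, add_zero]
    using wedge_transpose_mul_hodgeMatrix_mul_wedge_self (v + w)

/-- The Gram matrix of the bilinear form `(a, b) ↦ u ∧ a ∧ b` on `Λ²K⁵ = Λ²K⁴ ⊕ (e ∧ K⁴)`, where
`u = c • e + v`. -/
def koszulMatrix (c : K) (v : Fin 4 → K) : Matrix (Fin 6 ⊕ Fin 4) (Fin 6 ⊕ Fin 4) K :=
  Matrix.fromBlocks (c • hodgeMatrix K) (hodgeMatrix K * wedge v) ((wedge v)ᵀ * hodgeMatrix K) 0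

theorem rank_koszulMatrix_le (c : K) (v : Fin 4 → K) : (koszulMatrix c v).rank ≤ 6 := by
  obtain rfl | hc := eq_or_ne c 0
  · rw [koszulMatrix, zero_smul]
    refine (rank_fromBlocks_zero_zero_le _ _).trans (Nat.add_le_add (b := 3) (d := 3) ?_ ?_)
    · exact (Matrix.rank_mul_le_right _ _).trans (rank_wedge_le v)
    · exact (Matrix.rank_mul_le_left _ _).trans
        ((Matrix.rank_transpose _).trans_le (rank_wedge_le v))
  · have h : koszulMatrix c v = (Matrix.fromRows (c • hodgeMatrix K) ((wedge v)ᵀ * hodgeMatrix K)) *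
        (Matrix.fromCols 1 (c⁻¹ • wedge v) : Matrix (Fin 6) (Fin 6 ⊕ Fin 4) K) := by
      rw [Matrix.fromRows_mul_fromCols, koszulMatrix]
      simp only [Matrix.mul_one, Matrix.smul_mul, Matrix.mul_smul, smul_smul, Matrix.mul_assoc,
        inv_mul_cancel₀ hc, one_smul, wedge_transpose_mul_hodgeMatrix_mul_wedge_self, smul_zero]
    rw [h]
    exact (Matrix.rank_mul_le_left _ _).trans (Matrix.rank_le_card_width _)

variable (K) in
/-- The matrix of `y ↦ eᵢ ∧ y : K⁴ → Λ²K⁴` for a standard basis vector `eᵢ`. -/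
abbrev wedgeBasis (i : Fin 4) : Matrix (Fin 6) (Fin 4) K := wedge (Pi.single i 1)

theorem wedge_eq_sum (v : Fin 4 → K) : wedge v = ∑ i, v i • wedgeBasis K i := by
  simp_rw [← map_smul, ← map_sum, ← Pi.single_smul, smul_eq_mul, mul_one, Finset.univ_sum_single]

theorem exists_wedgeBasis_mulVec_single_eq (p : Fin 6) :
    ∃ i t, wedgeBasis K i *ᵥ Pi.single t 1 = Pi.single p 1 := by
  let pair : Fin 6 → Fin 4 × Fin 4 := ![(0, 1), (0, 2), (0, 3), (1, 2), (1, 3), (2, 3)]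
  refine ⟨(pair p).1, (pair p).2, ?_⟩
  ext k
  fin_cases p <;> fin_cases k <;> simp [pair, wedgeBasis, wedge]

variable {κ ι : Type*}

/-- The matrix representing `X₀, X₁, …, X₄`, seen as the slices of a tensor in `K⁵ ⊗ K^κ ⊗ K^κ`, as
the map `Λ²K⁵ ⊗ K^κ → Λ³K⁵ ⊗ K^κ`; here `Λ³K⁵` is identified with the dual of
`Λ²K⁵ = Λ²K⁴ ⊕ (e ∧ K⁴)` and `X₀` is the slice of `e`. -/
def koszulBlock (X₀ : Matrix κ κ K) (X : Fin 4 → Matrix κ κ K) :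
    Matrix (Fin 6 × κ ⊕ Fin 4 × κ) (Fin 6 × κ ⊕ Fin 4 × κ) K :=
  Matrix.fromBlocks (hodgeMatrix K ⊗ₖ X₀)
    (∑ i, (hodgeMatrix K * wedgeBasis K i) ⊗ₖ X i)
    (∑ i, ((wedgeBasis K i)ᵀ * hodgeMatrix K) ⊗ₖ X i) 0

theorem koszulBlock_smul (c : K) (v : Fin 4 → K) (Y : Matrix κ κ K) :
    koszulBlock (c • Y) (fun i => v i • Y) =
      (koszulMatrix c v ⊗ₖ Y).submatrix (Equiv.sumProdDistrib _ _ _).symm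
        (Equiv.sumProdDistrib _ _ _).symm := by
  rw [koszulMatrix, wedge_eq_sum]
  ext (⟨i, k⟩ | ⟨i, k⟩) (⟨j, l⟩ | ⟨j, l⟩) <;>
    simp [koszulBlock, Matrix.sum_apply, Matrix.mul_sum, Matrix.sum_mul, Finset.sum_mul,
      Matrix.transpose_sum, mul_left_comm, mul_assoc]

theorem rank_koszulBlock_smul_vecMulVec_le [Fintype κ] (c : K) (v : Fin 4 → K) (y z : κ → K) :
    (koszulBlock (c • Matrix.vecMulVec y z) fun i => v i • Matrix.vecMulVec y z).rank ≤ 6 := by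
  rw [koszulBlock_smul, Matrix.rank_submatrix]
  exact (rank_kronecker_vecMulVec_le _ _ _).trans (rank_koszulMatrix_le c v)

/-- The left factor in the factorization of `koszulBlock` when the slices are the Gram matrices of
multiplication by commuting elements of a Frobenius algebra. -/
def koszulFactor (N₀ : Matrix κ ι K) (N : Fin 4 → Matrix κ ι K) :
    Matrix (Fin 6 × κ ⊕ Fin 4 × κ) (Fin 6 × ι) K :=
  Matrix.fromRows (1 ⊗ₖ N₀) (∑ i, (wedgeBasis K i)ᵀ ⊗ₖ N i)

theorem sum_sum_eq_zero_of_antisymm {σ M : Type*} [Fintype σ] [AddCommGroup M]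
    {F : σ → σ → M} (hdiag : ∀ i, F i i = 0) (hF : ∀ i j, F j i = -F i j) :
    ∑ i, ∑ j, F i j = 0 := by
  classical
  rw [← Fintype.sum_prod_type']
  refine Finset.sum_involution (fun p _ => p.swap) (fun p _ => ?_) (fun p _ hp hswap => hp ?_)
    (fun p _ => Finset.mem_univ _) fun p _ => p.swap_swap
  · rw [Prod.fst_swap, Prod.snd_swap, hF p.1 p.2, add_neg_cancel]
  · rw [← Prod.ext_iff.1 hswap |>.1]
    exact hdiag _

theorem sum_wedge_kronecker_mul_hodgeMatrix_kronecker_mul_eq_zero [Fintype ι]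
    {N : Fin 4 → Matrix κ ι K} {S : Matrix ι ι K}
    (hN : ∀ i j, N i * S * (N j)ᵀ = N j * S * (N i)ᵀ) :
    (∑ i, (wedgeBasis K i)ᵀ ⊗ₖ N i) * (hodgeMatrix K ⊗ₖ S) *
      (∑ i, (wedgeBasis K i)ᵀ ⊗ₖ N i)ᵀ = 0 := by
  simp only [Matrix.mul_assoc] at hN
  simp only [Matrix.transpose_sum, ← Matrix.kroneckerMap_transpose, Matrix.transpose_transpose,
    Matrix.sum_mul, Matrix.mul_sum, ← Matrix.mul_kronecker_mul, Matrix.mul_assoc]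
  refine sum_sum_eq_zero_of_antisymm (fun i => ?_) fun i j => ?_
  · rw [wedge_transpose_mul_hodgeMatrix_mul_wedge_self, Matrix.zero_kronecker]
  · rw [wedge_transpose_mul_hodgeMatrix_mul_wedge_antisymm, hN j i]
    ext p q
    exact neg_mul _ _

theorem koszulBlock_eq_koszulFactor_mul [Fintype ι] {N₀ : Matrix κ ι K} {N : Fin 4 → Matrix κ ι K}
    {S : Matrix ι ι K} (hN₀ : ∀ i, N i * S * N₀ᵀ = N₀ * S * (N i)ᵀ)
    (hN : ∀ i j, N i * S * (N j)ᵀ = N j * S * (N i)ᵀ) :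
    koszulBlock (N₀ * S * N₀ᵀ) (fun i => N₀ * S * (N i)ᵀ) =
      koszulFactor N₀ N * (hodgeMatrix K ⊗ₖ S) * (koszulFactor N₀ N)ᵀ := by
  rw [koszulFactor, Matrix.transpose_fromRows, Matrix.fromRows_mul, Matrix.fromRows_mul_fromCols,
    sum_wedge_kronecker_mul_hodgeMatrix_kronecker_mul_eq_zero hN, koszulBlock]
  simp only [Matrix.transpose_sum, ← Matrix.kroneckerMap_transpose, Matrix.transpose_transpose,
    Matrix.sum_mul, Matrix.mul_sum, ← Matrix.mul_kronecker_mul, Matrix.transpose_one,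
    Matrix.one_mul, Matrix.mul_one, hN₀]

theorem koszulFactor_mulVec_injective [Fintype ι] {N₀ : Matrix κ ι K} {N : Fin 4 → Matrix κ ι K}
    (h : ∀ X : Matrix ι (Fin 6) K, N₀ * X = 0 → ∑ i, N i * X * wedgeBasis K i = 0 → X = 0) :
    Function.Injective (koszulFactor N₀ N).mulVec := by
  rw [← Matrix.coe_mulVecLin, ← LinearMap.ker_eq_bot, LinearMap.ker_eq_bot']
  intro x hx
  obtain ⟨X, rfl⟩ := Matrix.vec_bijective.2 x
  rw [Matrix.mulVecLin_apply, koszulFactor, Matrix.fromRows_mulVec, Matrix.sum_mulVec] at hx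
  simp only [Matrix.kronecker_mulVec_vec, Matrix.transpose_one, Matrix.mul_one,
    Matrix.transpose_transpose, ← Matrix.vec_sum] at hx
  rw [Matrix.vec_eq_zero_iff]
  refine h X (Matrix.vec_eq_zero_iff.1 ?_) (Matrix.vec_eq_zero_iff.1 ?_)
  · exact funext fun k => congrFun hx (Sum.inl k)
  · exact funext fun k => congrFun hx (Sum.inr k)

theorem card_le_rank_koszulBlock [Fintype κ] [Fintype ι] [DecidableEq ι] {N₀ : Matrix κ ι K}
    {N : Fin 4 → Matrix κ ι K} {S : Matrix ι ι K} (hS : IsUnit S)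
    (hN₀ : ∀ i, N i * S * N₀ᵀ = N₀ * S * (N i)ᵀ) (hN : ∀ i j, N i * S * (N j)ᵀ = N j * S * (N i)ᵀ)
    (hker : ∀ X : Matrix ι (Fin 6) K,
      N₀ * X = 0 → ∑ i, N i * X * wedgeBasis K i = 0 → X = 0) :
    6 * Fintype.card ι ≤ (koszulBlock (N₀ * S * N₀ᵀ) fun i => N₀ * S * (N i)ᵀ).rank := by
  have hG : IsUnit (hodgeMatrix K ⊗ₖ S) :=
    Matrix.IsUnit.kronecker (.of_mul_eq_one _ hodgeMatrix_mul_self) hS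
  rw [koszulBlock_eq_koszulFactor_mul hN₀ hN]
  simpa only [Fintype.card_prod, Fintype.card_fin] using
    card_le_rank_mul_mul_transpose (koszulFactor_mulVec_injective hker) hG

end Koszul

section Words

variable {α β : Type*}

/-- Words of length three; a word over the index set of a basis indexes the basis of the third
tensor power, bracketed as in `kroneckerCube`. -/
abbrev Word (α : Type*) := (α × α) × α

/-- The letterwise image of a word. -/
def Word.map (f : α → β) : Word α → Word β := Prod.map (Prod.map f f) f

/-- The word with the given letters, provided that all three are defined. -/
def zipWord (x y z : Option α) : Option (Word α) :=
  x.bind fun a => y.bind fun b => z.map fun c => ((a, b), c)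

theorem elim_bind {γ : Type*} (x : Option α) (f : α → Option β) (c : γ) (F : β → γ) :
    (x.bind f).elim c F = x.elim c fun a => (f a).elim c F := by
  cases x <;> rfl

theorem zipWord_bind (x y z : Option α) (f g h : α → Option β) :
    (zipWord x y z).bind (fun m => zipWord (f m.1.1) (g m.1.2) (h m.2)) =
      zipWord (x.bind f) (y.bind g) (z.bind h) := by
  rcases x with _ | a <;> rcases y with _ | b <;> rcases z with _ | c <;> simp [zipWord]

theorem zipWord_eq_some {x y z : Option α} {m : Word α} :
    zipWord x y z = some m ↔ x = some m.1.1 ∧ y = some m.1.2 ∧ z = some m.2 := by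
  rcases x with _ | a <;> rcases y with _ | b <;> rcases z with _ | c <;>
    simp [zipWord, Prod.ext_iff, and_assoc]

theorem zipWord_map (x y z : Option α) (f : α → β) :
    zipWord (x.map f) (y.map f) (z.map f) = (zipWord x y z).map (Word.map f) := by
  rcases x with _ | a <;> rcases y with _ | b <;> rcases z with _ | c <;>
    simp [zipWord, Word.map]

/-- The letters of `Fin 7` as elements of `α`: `Fin 6` through `g`, and the last letter as `r`. -/
def extendLetter (g : Fin 6 → α) (r : Option α) : Fin 7 → Option α :=
  Fin.lastCases r fun a => some (g a)

/-- The extension of a partial map of letters to the socle generator. -/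
def socleExtend (θ : β → Option α) (x : Option β) : Option (Option α) :=
  x.elim (some none) fun d => (θ d).map some

theorem exists_socleExtend_eq (g : Fin 6 → α) (k : Option α) :
    ∃ r : Option α, (∀ a ∈ r, a ∉ Set.range g) ∧
      ∃ d, socleExtend (extendLetter g r) d = some k := by
  rcases k with _ | a
  · exact ⟨none, by simp, none, rfl⟩
  by_cases ha : a ∈ Set.range g
  · obtain ⟨d, rfl⟩ := ha
    exact ⟨none, by simp, some d.castSucc, by simp [socleExtend, extendLetter]⟩
  · exact ⟨some a, by simpa using ha, some (Fin.last 6), by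
      simp only [socleExtend, extendLetter, Option.elim_some, Fin.lastCases_last, Option.map_some]⟩

variable [DecidableEq α] [Zero α]

/-- The product of two of the elements `1, x_a` in the Frobenius algebra with basis
`1, x_a (a ≠ 0), s` and products `x_a x_b = δ_ab s`, `x_a s = s² = 0`. The letter `0` is the unit,
and `none : Option α` is the socle generator `s`; a vanishing product is
`none : Option (Option α)`. -/
def letterMul (a b : α) : Option (Option α) :=
  if a = 0 then some (some b)
  else if b = 0 then some (some a)
  else if a = b then some none
  else none

/-- The letterwise product of two words. -/
def wordMul (μ m : Word α) : Option (Word (Option α)) :=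
  zipWord (letterMul μ.1.1 m.1.1) (letterMul μ.1.2 m.1.2) (letterMul μ.2 m.2)

/-- The words whose sums `f₀, f₁, f₂, f₃`, together with the unit, span the subspace used in the
Koszul flattening. Rotating the words fixes `f₀` and permutes `f₁, f₂, f₃`; the words were found by
computer search. -/
def supports : Fin 4 → List (Word (Fin 6))
  | 0 => [((0, 0), 4), ((0, 4), 0), ((4, 0), 0), ((0, 1), 5), ((1, 5), 0), ((5, 0), 1)]
  | 1 => [((1, 0), 0), ((0, 2), 0), ((0, 0), 3), ((0, 3), 1), ((2, 0), 5), ((3, 1), 4)]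
  | 2 => [((0, 1), 0), ((0, 0), 2), ((3, 0), 0), ((1, 0), 3), ((5, 2), 0), ((4, 3), 1)]
  | 3 => [((0, 0), 1), ((2, 0), 0), ((0, 3), 0), ((3, 1), 0), ((0, 5), 2), ((1, 4), 3)]

/-- The equations satisfied by the coordinates `W i t` of `X (eᵢ ∧ eₜ)` for `X` in the kernel of the
Koszul factor. -/
structure IsKernelFamily {M : Type*} [AddCommGroup M] (g : Fin 6 → α)
    (W : Fin 4 → Fin 4 → Word (Option α) → M) : Prop where
  self_eq_zero : ∀ i k, W i i k = 0
  antisymm : ∀ i t k, W t i k = -W i t k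
  socle_free : ∀ i t m, W i t (Word.map some m) = 0
  relation : ∀ t m,
    ∑ i, ((supports i).map fun μ => (wordMul (Word.map g μ) m).elim 0 (W i t)).sum = 0

theorem letterMul_bind_socleExtend {g : Fin 6 → α} (hg : Function.Injective g) (hg₀ : g 0 = 0)
    {r : Option α} (hr : ∀ a ∈ r, a ∉ Set.range g) (a : Fin 6) (d : Fin 7) :
    (letterMul a.castSucc d).bind (socleExtend (extendLetter g r)) =
      (extendLetter g r d).bind (letterMul (g a)) := by
  have hg₀' (b : Fin 6) : g b = 0 ↔ b = 0 := by rw [← hg₀, hg.eq_iff]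
  have hcast (b : Fin 6) : b.castSucc = 0 ↔ b = 0 := Fin.castSucc_eq_zero_iff
  induction d using Fin.lastCases with
  | last =>
    have hlast : extendLetter g r (Fin.last 6) = r := Fin.lastCases_last
    have hr' : ∀ b ∈ r, b ≠ 0 ∧ g a ≠ b := fun b hb =>
      ⟨fun h => hr b hb ⟨0, hg₀.trans h.symm⟩, fun h => hr b hb ⟨a, h⟩⟩
    rw [hlast]
    by_cases ha : a = 0
    · rw [letterMul, if_pos ((hcast a).2 ha), ha, hg₀]
      cases r <;> simp only [socleExtend, Option.bind_some, Option.elim_some, hlast,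
        Option.map_none, Option.map_some, Option.bind_none, letterMul, if_true]
    · rw [letterMul, if_neg ((hcast a).not.2 ha), if_neg (Fin.last_pos.ne'),
        if_neg (Fin.castSucc_ne_last a)]
      rcases r with _ | b
      · rfl
      · simp [letterMul, hg₀', ha, hr' b rfl]
  | cast b =>
    have hb : extendLetter g r b.castSucc = some (g b) := Fin.lastCases_castSucc b
    rw [hb]
    simp only [letterMul, hg₀', hcast, Option.bind_some, hg.eq_iff, Fin.castSucc_inj]
    split_ifs <;> simp [socleExtend, extendLetter]

theorem IsKernelFamily.transfer {M : Type*} [AddCommGroup M] {g : Fin 6 → α}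
    (hg : Function.Injective g) (hg₀ : g 0 = 0) {W : Fin 4 → Fin 4 → Word (Option α) → M}
    (hW : IsKernelFamily g W) {r₁ r₂ r₃ : Option α} (hr₁ : ∀ a ∈ r₁, a ∉ Set.range g)
    (hr₂ : ∀ a ∈ r₂, a ∉ Set.range g) (hr₃ : ∀ a ∈ r₃, a ∉ Set.range g) :
    IsKernelFamily Fin.castSucc fun i t k =>
      (zipWord (socleExtend (extendLetter g r₁) k.1.1) (socleExtend (extendLetter g r₂) k.1.2)
        (socleExtend (extendLetter g r₃) k.2)).elim 0 (W i t) where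
  self_eq_zero i k := by
    cases zipWord _ _ _ <;> simp [hW.self_eq_zero]
  antisymm i t k := by
    cases zipWord _ _ _ <;> simp [hW.antisymm i t]
  socle_free i t m := by
    change (zipWord (Option.map some _) (Option.map some _) (Option.map some _)).elim 0 (W i t) = 0
    rw [zipWord_map]
    cases zipWord _ _ _ <;> simp [hW.socle_free]
  relation t m := by
    have hmul (i : Fin 4) (μ : Word (Fin 6)) :
        (wordMul (Word.map Fin.castSucc μ) m).elim 0 (fun k =>
          (zipWord (socleExtend (extendLetter g r₁) k.1.1) (socleExtend (extendLetter g r₂) k.1.2)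
            (socleExtend (extendLetter g r₃) k.2)).elim 0 (W i t)) =
        (zipWord (extendLetter g r₁ m.1.1) (extendLetter g r₂ m.1.2) (extendLetter g r₃ m.2)).elim 0
          fun m' => (wordMul (Word.map g μ) m').elim 0 (W i t) := by
      rw [← elim_bind, ← elim_bind, wordMul, zipWord_bind]
      simp only [Word.map, Prod.map_fst, Prod.map_snd]
      rw [letterMul_bind_socleExtend hg hg₀ hr₁, letterMul_bind_socleExtend hg hg₀ hr₂,
        letterMul_bind_socleExtend hg hg₀ hr₃, ← zipWord_bind]
      rfl
    simp only [hmul]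
    cases zipWord _ _ _ with
    | none => simp
    | some m' => exact hW.relation t m'

end Words

section Propagation

variable {ι M : Type*}

/-- Unit propagation along a list of equations, each the list of the unknowns whose sum vanishes.
The unknowns already known to vanish are the bits of `known` at their codes; the set is a natural
number because the kernel computes with these in binary. -/
def propagate (code : ι → ℕ) (known : ℕ) : List (List ι) → ℕ
  | [] => known
  | r :: rs =>
    match r.filter fun x => !known.testBit (code x) with
    | [x] => propagate code (known ||| 1 <<< code x) rs
    | _ => propagate code known rs

theorem sum_map_filter_eq_of_forall_eq_zero [AddCommMonoid M] {p : ι → Bool} {W : ι → M}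
    (hW : ∀ x, p x = false → W x = 0) (l : List ι) : ((l.filter p).map W).sum = (l.map W).sum := by
  induction l with
  | nil => rfl
  | cons x l ih => cases hx : p x <;> simp [hx, ih, hW]

theorem sum_map_flatMap {κ : Type*} [AddCommMonoid M] (l : List κ) (f : κ → List ι) (W : ι → M) :
    ((l.flatMap f).map W).sum = (l.map fun a => ((f a).map W).sum).sum := by
  rw [List.map_flatMap, List.flatMap_def, List.sum_flatten, List.map_map]
  rfl

theorem eq_zero_of_testBit_propagate [AddCommMonoid M] {code : ι → ℕ} {W : ι → M}
    (hcode : ∀ x y, code x = code y → W x = 0 → W y = 0) {rs : List (List ι)}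
    (hrs : ∀ r ∈ rs, (r.map W).sum = 0) {known : ℕ}
    (hknown : ∀ x, known.testBit (code x) → W x = 0) {x : ι}
    (hx : (propagate code known rs).testBit (code x)) : W x = 0 := by
  induction rs generalizing known with
  | nil => exact hknown x hx
  | cons r rs ih =>
    have hrs' : ∀ r ∈ rs, (r.map W).sum = 0 := fun r' h => hrs r' (List.mem_cons_of_mem r h)
    rw [propagate] at hx
    split at hx
    · next y hy =>
      have hsum : ((r.filter fun x => !known.testBit (code x)).map W).sum = 0 :=
        (sum_map_filter_eq_of_forall_eq_zero (fun z hz => hknown z (by simpa using hz)) r).trans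
          (hrs r List.mem_cons_self)
      have hWy : W y = 0 := by simpa [hy] using hsum
      refine ih hrs' (fun z hz => ?_) hx
      rw [Nat.testBit_or, Bool.or_eq_true] at hz
      refine hz.elim (hknown z) fun hz => hcode y z ?_ hWy
      rw [Nat.testBit_shiftLeft, Bool.and_eq_true, Nat.testBit_one_eq_true_iff_self_eq_zero,
        decide_eq_true_eq] at hz
      omega
    · exact ih hrs' hknown hx

end Propagation

section Elimination

/-- An unknown `W i t k` of a kernel family for seven letters. -/
abbrev Unknown := (Fin 4 × Fin 4) × Word (Option (Fin 7))

/-- The number of a letter, the socle generator coming last. -/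
def letterCode (x : Option (Fin 7)) : ℕ := x.elim 7 Fin.val

/-- The number of an unknown; `W i t k` and `W t i k = -W i t k` share it. -/
def unknownCode (x : Unknown) : ℕ :=
  512 * (4 * min x.1.1.val x.1.2.val + max x.1.1.val x.1.2.val) +
    64 * letterCode x.2.1.1 + 8 * letterCode x.2.1.2 + letterCode x.2.2

/-- The unknowns `W i t k` not vanishing by antisymmetry or `IsKernelFamily.socle_free`. -/
def Unknown.isEssential (x : Unknown) : Bool :=
  x.1.1 != x.1.2 && (x.2.1.1.isNone || x.2.1.2.isNone || x.2.2.isNone)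

/-- The words with letters in a given list. -/
def wordsOver {α : Type*} (l : List α) : List (Word α) := (l ×ˢ l) ×ˢ l

/-- The unknowns in the equation `IsKernelFamily.relation`, without those known to vanish. -/
def kernelRelation (t : Fin 4) (m : Word (Fin 7)) : List Unknown :=
  ((List.finRange 4).flatMap fun i => (supports i).flatMap fun μ =>
    (wordMul (Word.map Fin.castSucc μ) m).toList.map (Prod.mk (i, t))).filter Unknown.isEssential

/-- One round of unit propagation through all equations of a kernel family for seven letters. -/
def eliminationPass (known : ℕ) : ℕ :=
  propagate unknownCode known <|
    (List.finRange 4).flatMap fun t => (wordsOver (List.finRange 7)).map (kernelRelation t)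

theorem testBit_iterate_eliminationPass : ∀ i t : Fin 4, i ≠ t →
    ∀ k ∈ wordsOver (none :: (List.finRange 7).map some), Unknown.isEssential ((i, t), k) →
      (eliminationPass^[22] 0).testBit (unknownCode ((i, t), k)) := by
  decide +kernel

theorem mem_wordsOver {α : Type*} {l : List α} (hl : ∀ a, a ∈ l) (m : Word α) :
    m ∈ wordsOver l :=
  List.pair_mem_product.2 ⟨List.pair_mem_product.2 ⟨hl _, hl _⟩, hl _⟩

theorem unknownCode_eq_iff {i t j u : Fin 4} {k l : Word (Option (Fin 7))} :
    unknownCode ((i, t), k) = unknownCode ((j, u), l) ↔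
      (i = j ∧ t = u ∨ i = u ∧ t = j) ∧ k = l := by
  have hlt (x : Option (Fin 7)) : letterCode x < 8 := by
    cases x <;> simp [letterCode]; omega
  have hinj (x y : Option (Fin 7)) : x = y ↔ letterCode x = letterCode y := by
    revert x y; decide
  have hk₁ := hlt k.1.1
  have hk₂ := hlt k.1.2
  have hk₃ := hlt k.2
  have hl₁ := hlt l.1.1
  have hl₂ := hlt l.1.2
  have hl₃ := hlt l.2
  simp only [unknownCode, Prod.ext_iff, hinj, Fin.ext_iff]
  omega

namespace IsKernelFamily

variable {M : Type*} [AddCommGroup M]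

theorem eq_zero_of_not_isEssential {W : Fin 4 → Fin 4 → Word (Option (Fin 7)) → M}
    (hW : IsKernelFamily Fin.castSucc W) {x : Unknown} (hx : x.isEssential = false) :
    W x.1.1 x.1.2 x.2 = 0 := by
  obtain ⟨⟨i, t⟩, ⟨⟨_ | a, _ | b⟩, _ | c⟩⟩ := x <;>
    simp only [Unknown.isEssential, Option.isNone_none, Option.isNone_some, Bool.or_true,
      Bool.and_true, Bool.or_false, Bool.and_false, bne_eq_false_iff_eq] at hx
  all_goals first
    | exact hW.socle_free i t ((a, b), c)
    | exact hx ▸ hW.self_eq_zero i _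

theorem sum_map_kernelRelation {W : Fin 4 → Fin 4 → Word (Option (Fin 7)) → M}
    (hW : IsKernelFamily Fin.castSucc W) (t : Fin 4) (m : Word (Fin 7)) :
    ((kernelRelation t m).map fun x => W x.1.1 x.1.2 x.2).sum = 0 := by
  rw [kernelRelation, sum_map_filter_eq_of_forall_eq_zero fun x => hW.eq_zero_of_not_isEssential,
    sum_map_flatMap, ← Fin.sum_univ_def, ← hW.relation t m]
  refine Finset.sum_congr rfl fun i _ => ?_
  rw [sum_map_flatMap]
  refine congrArg List.sum (List.map_congr_left fun μ _ => ?_)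
  cases wordMul (Word.map Fin.castSucc μ) m <;> simp

theorem eq_zero_of_castSucc {W : Fin 4 → Fin 4 → Word (Option (Fin 7)) → M}
    (hW : IsKernelFamily Fin.castSucc W) (i t : Fin 4) (k : Word (Option (Fin 7))) :
    W i t k = 0 := by
  have hcode (x y : Unknown) (hxy : unknownCode x = unknownCode y)
      (hx : W x.1.1 x.1.2 x.2 = 0) : W y.1.1 y.1.2 y.2 = 0 := by
    obtain ⟨⟨hi, ht⟩ | ⟨hi, ht⟩, hk⟩ := unknownCode_eq_iff.1 hxy
    · rw [← hi, ← ht, ← hk, hx]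
    · rw [hW.antisymm, ← hi, ← ht, ← hk, hx, neg_zero]
  have hpass (n : ℕ) (x : Unknown) (hx : (eliminationPass^[n] 0).testBit (unknownCode x)) :
      W x.1.1 x.1.2 x.2 = 0 := by
    induction n generalizing x with
    | zero => simp at hx
    | succ n ih =>
      rw [Function.iterate_succ_apply', eliminationPass] at hx
      refine eq_zero_of_testBit_propagate (W := fun x => W x.1.1 x.1.2 x.2) hcode ?_ ih hx
      intro r hr
      obtain ⟨u, -, hr⟩ := List.mem_flatMap.1 hr
      obtain ⟨m, -, rfl⟩ := List.mem_map.1 hr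
      exact hW.sum_map_kernelRelation u m
  cases hx : Unknown.isEssential ((i, t), k) with
  | false => exact hW.eq_zero_of_not_isEssential hx
  | true =>
    have hit : i ≠ t := by
      rintro rfl
      simp [Unknown.isEssential] at hx
    have hletter (a : Option (Fin 7)) : a ∈ none :: (List.finRange 7).map some := by
      cases a <;> simp
    exact hpass 22 ((i, t), k)
      (testBit_iterate_eliminationPass i t hit k (mem_wordsOver hletter k) hx)

theorem eq_zero {α : Type*} [DecidableEq α] [Zero α] {g : Fin 6 → α} (hg : Function.Injective g)
    (hg₀ : g 0 = 0) {W : Fin 4 → Fin 4 → Word (Option α) → M} (hW : IsKernelFamily g W)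
    (i t : Fin 4) (k : Word (Option α)) : W i t k = 0 := by
  obtain ⟨r₁, hr₁, d₁, hd₁⟩ := exists_socleExtend_eq g k.1.1
  obtain ⟨r₂, hr₂, d₂, hd₂⟩ := exists_socleExtend_eq g k.1.2
  obtain ⟨r₃, hr₃, d₃, hd₃⟩ := exists_socleExtend_eq g k.2
  have h := (hW.transfer hg hg₀ hr₁ hr₂ hr₃).eq_zero_of_castSucc i t ((d₁, d₂), d₃)
  simpa only [hd₁, hd₂, hd₃, zipWord_eq_some.2 ⟨rfl, rfl, rfl⟩, Option.elim_some] using h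

end IsKernelFamily

end Elimination

section Algebra

variable {K : Type*} [Field K] {α : Type*} [DecidableEq α] [Zero α]

variable (K) in
/-- Multiplication by `a` in the Frobenius algebra of `letterMul`, as a matrix in the bases indexed
by `α` and `Option α`. -/
def letterMatrix (a : α) : Matrix α (Option α) K :=
  Matrix.of fun b k => if letterMul a b = some k then 1 else 0

variable (K) in
/-- The third tensor power of `letterMatrix`. -/
def wordMatrix (μ : Word α) : Matrix (Word α) (Word (Option α)) K :=
  (letterMatrix K μ.1.1 ⊗ₖ letterMatrix K μ.1.2) ⊗ₖ letterMatrix K μ.2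

theorem wordMatrix_apply (μ m : Word α) (k : Word (Option α)) :
    wordMatrix K μ m k = if wordMul μ m = some k then 1 else 0 := by
  simp only [wordMatrix, letterMatrix, wordMul, zipWord_eq_some, Matrix.kroneckerMap_apply,
    Matrix.of_apply, ite_and]
  split_ifs <;> simp

theorem wordMatrix_mulVec [Fintype α] (μ m : Word α) (v : Word (Option α) → K) :
    (wordMatrix K μ *ᵥ v) m = (wordMul μ m).elim 0 v := by
  simp only [Matrix.mulVec, dotProduct, wordMatrix_apply, ite_mul, one_mul, zero_mul]
  cases wordMul μ m <;> simp

variable (K α) in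
/-- The Gram matrix of the trace form `(x, y) ↦ λ (x y)` in the Frobenius algebra, where `λ` is the
coefficient of the socle generator, in the basis `1, x_a, s`. -/
def traceForm : Matrix (Option α) (Option α) K :=
  (Equiv.swap none (some 0)).permMatrix K

variable (K α) in
/-- The third tensor power of `traceForm`. -/
def wordTraceForm : Matrix (Word (Option α)) (Word (Option α)) K :=
  (traceForm K α ⊗ₖ traceForm K α) ⊗ₖ traceForm K α

theorem isUnit_wordTraceForm [Fintype α] : IsUnit (wordTraceForm K α) := by
  have h : IsUnit (traceForm K α) := by
    refine .of_mul_eq_one (traceForm K α) ?_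
    rw [traceForm, ← Matrix.permMatrix_mul, Equiv.swap_mul_self, Matrix.permMatrix_one]
  exact Matrix.IsUnit.kronecker (Matrix.IsUnit.kronecker h h) h

theorem letterMatrix_mul_traceForm_mul_comm [Fintype α] (a b : α) :
    letterMatrix K a * traceForm K α * (letterMatrix K b)ᵀ =
      letterMatrix K b * traceForm K α * (letterMatrix K a)ᵀ := by
  ext c d
  rw [traceForm, Equiv.Perm.permMatrix, PEquiv.mul_toMatrix_toPEquiv, PEquiv.mul_toMatrix_toPEquiv]
  simp only [Matrix.mul_apply, Matrix.submatrix_apply, Matrix.transpose_apply, letterMatrix,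
    Matrix.of_apply, id_eq, Equiv.symm_swap, letterMul]
  by_cases ha : a = 0 <;> by_cases hb : b = 0 <;> by_cases hc : c = 0 <;> by_cases hd : d = 0 <;>
    simp [ha, hb, hc, hd, Fintype.sum_option, Equiv.swap_apply_def, eq_comm]

theorem wordMatrix_mul_wordTraceForm_mul_comm [Fintype α] (μ ν : Word α) :
    wordMatrix K μ * wordTraceForm K α * (wordMatrix K ν)ᵀ =
      wordMatrix K ν * wordTraceForm K α * (wordMatrix K μ)ᵀ := by
  simp only [wordMatrix, wordTraceForm, ← Matrix.kroneckerMap_transpose, ← Matrix.mul_kronecker_mul,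
    letterMatrix_mul_traceForm_mul_comm]

variable (K) in
/-- Multiplication by `fᵢ`, the sum of the words in `supports i` read through `g`. -/
def supportMatrix (g : Fin 6 → α) (i : Fin 4) : Matrix (Word α) (Word (Option α)) K :=
  ((supports i).map fun μ => wordMatrix K (Word.map g μ)).sum

theorem supportMatrix_mulVec [Fintype α] (g : Fin 6 → α) (i : Fin 4) (m : Word α)
    (v : Word (Option α) → K) :
    (supportMatrix K g i *ᵥ v) m =
      ((supports i).map fun μ => (wordMul (Word.map g μ) m).elim 0 v).sum := by
  rw [supportMatrix]
  induction supports i with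
  | nil => simp
  | cons μ l ih =>
    simp only [List.map_cons, List.sum_cons, Matrix.add_mulVec, Pi.add_apply, wordMatrix_mulVec, ih]

theorem wordMul_zero (m : Word α) : wordMul 0 m = some (Word.map some m) := by
  simp only [wordMul, letterMul, zipWord, Word.map, Prod.fst_zero, Prod.snd_zero, if_true,
    Option.bind_some, Option.map_some]
  rfl

theorem isKernelFamily_of_mul_eq_zero [Fintype α] {g : Fin 6 → α}
    {X : Matrix (Word (Option α)) (Fin 6) K} (h₀ : wordMatrix K (0 : Word α) * X = 0)
    (h : ∑ i, supportMatrix K g i * X * wedgeBasis K i = 0) :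
    IsKernelFamily g fun i t => X *ᵥ (wedgeBasis K i *ᵥ Pi.single t 1) where
  self_eq_zero i k := by rw [wedge_mulVec_self, Matrix.mulVec_zero, Pi.zero_apply]
  antisymm i t k := by rw [wedge_mulVec_antisymm, Matrix.mulVec_neg, Pi.neg_apply]
  socle_free i t m := by
    have hm := wordMatrix_mulVec 0 m (X *ᵥ (wedgeBasis K i *ᵥ Pi.single t 1))
    rw [Matrix.mulVec_mulVec, h₀, Matrix.zero_mulVec, wordMul_zero] at hm
    exact hm.symm
  relation t m := by
    have htm := congrFun (congrArg (· *ᵥ Pi.single t 1) h) m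
    simpa only [Matrix.sum_mulVec, ← Matrix.mulVec_mulVec, Finset.sum_apply, supportMatrix_mulVec,
      Matrix.zero_mulVec, Pi.zero_apply] using htm

theorem eq_zero_of_supportMatrix_mul_eq_zero [Fintype α] {g : Fin 6 → α}
    (hg : Function.Injective g) (hg₀ : g 0 = 0) {X : Matrix (Word (Option α)) (Fin 6) K}
    (h₀ : wordMatrix K (0 : Word α) * X = 0)
    (h : ∑ i, supportMatrix K g i * X * wedgeBasis K i = 0) : X = 0 := by
  refine Matrix.ext_of_mulVec_single fun p => ?_
  obtain ⟨i, t, hp⟩ := exists_wedgeBasis_mulVec_single_eq (K := K) p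
  rw [← hp, Matrix.zero_mulVec]
  exact funext fun k => (isKernelFamily_of_mul_eq_zero h₀ h).eq_zero hg hg₀ i t k

theorem list_sum_mul_mul_transpose_comm {κ ι : Type*} [Fintype ι] {S : Matrix ι ι K}
    {l : List (Matrix κ ι K)} {B : Matrix κ ι K} (h : ∀ A ∈ l, A * S * Bᵀ = B * S * Aᵀ) :
    l.sum * S * Bᵀ = B * S * l.sumᵀ := by
  induction l with
  | nil => simp
  | cons A l ih =>
    rw [List.forall_mem_cons] at h
    simp only [List.sum_cons, Matrix.add_mul, Matrix.transpose_add, Matrix.mul_add, h.1, ih h.2]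

theorem supportMatrix_mul_wordTraceForm_mul_wordMatrix_comm [Fintype α] (g : Fin 6 → α)
    (i : Fin 4) (ν : Word α) :
    supportMatrix K g i * wordTraceForm K α * (wordMatrix K ν)ᵀ =
      wordMatrix K ν * wordTraceForm K α * (supportMatrix K g i)ᵀ := by
  refine list_sum_mul_mul_transpose_comm fun A hA => ?_
  obtain ⟨μ, -, rfl⟩ := List.mem_map.1 hA
  exact wordMatrix_mul_wordTraceForm_mul_comm _ ν

theorem supportMatrix_mul_wordTraceForm_mul_comm [Fintype α] (g : Fin 6 → α) (i j : Fin 4) :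
    supportMatrix K g i * wordTraceForm K α * (supportMatrix K g j)ᵀ =
      supportMatrix K g j * wordTraceForm K α * (supportMatrix K g i)ᵀ := by
  refine list_sum_mul_mul_transpose_comm fun A hA => ?_
  obtain ⟨μ, -, rfl⟩ := List.mem_map.1 hA
  exact (supportMatrix_mul_wordTraceForm_mul_wordMatrix_comm g j _).symm

theorem card_le_rank_koszulBlock_supportMatrix [Fintype α] {g : Fin 6 → α}
    (hg : Function.Injective g) (hg₀ : g 0 = 0) :
    6 * (Fintype.card α + 1) ^ 3 ≤
      (koszulBlock (wordMatrix K (0 : Word α) * wordTraceForm K α * (wordMatrix K 0)ᵀ) fun i =>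
        wordMatrix K (0 : Word α) * wordTraceForm K α * (supportMatrix K g i)ᵀ).rank := by
  have hcard : (Fintype.card α + 1) ^ 3 = Fintype.card (Word (Option α)) := by
    simp only [Fintype.card_prod, Fintype.card_option]
    ring
  rw [hcard]
  exact card_le_rank_koszulBlock isUnit_wordTraceForm
    (fun i => supportMatrix_mul_wordTraceForm_mul_wordMatrix_comm g i 0)
    (supportMatrix_mul_wordTraceForm_mul_comm g)
    fun X => eq_zero_of_supportMatrix_mul_eq_zero hg hg₀

end Algebra

section Flattening

variable {A B C A' B' C' κ κ' : Type*}
  [AddCommGroup A] [Module ℂ A] [AddCommGroup B] [Module ℂ B] [AddCommGroup C] [Module ℂ C]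
  [AddCommGroup A'] [Module ℂ A'] [AddCommGroup B'] [Module ℂ B'] [AddCommGroup C'] [Module ℂ C']

/-- The Kronecker product as a bilinear map. -/
noncomputable def kroneckerBilinear : A ⊗[ℂ] (B ⊗[ℂ] C) →ₗ[ℂ] A' ⊗[ℂ] (B' ⊗[ℂ] C') →ₗ[ℂ]
    (A ⊗[ℂ] A') ⊗[ℂ] ((B ⊗[ℂ] B') ⊗[ℂ] (C ⊗[ℂ] C')) :=
  (TensorProduct.mk ℂ (A ⊗[ℂ] (B ⊗[ℂ] C)) (A' ⊗[ℂ] (B' ⊗[ℂ] C'))).compr₂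
    ((TensorProduct.tensorTensorTensorComm ℂ B C B' C').toLinearMap.lTensor (A ⊗[ℂ] A') ∘ₗ
      (TensorProduct.tensorTensorTensorComm ℂ A (B ⊗[ℂ] C) A' (B' ⊗[ℂ] C')).toLinearMap)

theorem kronecker_sum_sum {ι ι' : Type*} (s : Finset ι) (s' : Finset ι')
    (T : ι → A ⊗[ℂ] (B ⊗[ℂ] C)) (S : ι' → A' ⊗[ℂ] (B' ⊗[ℂ] C')) :
    kronecker (∑ i ∈ s, T i) (∑ j ∈ s', S j) = ∑ i ∈ s, ∑ j ∈ s', kronecker (T i) (S j) :=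
  LinearMap.map_sum₂ kroneckerBilinear s T _ |>.trans <|
    Finset.sum_congr rfl fun i _ => map_sum (kroneckerBilinear (T i)) S s'

/-- The slice of a tensor of order three along a functional on the first factor, as a matrix in
the coordinates `β` and `γ` on the other two factors. -/
noncomputable def tensorSlice (β : κ → Module.Dual ℂ B) (γ : κ' → Module.Dual ℂ C) :
    Module.Dual ℂ A →ₗ[ℂ] A ⊗[ℂ] (B ⊗[ℂ] C) →ₗ[ℂ] Matrix κ κ' ℂ :=
  LinearMap.mk₂ ℂ
    (fun φ T => Matrix.of fun b c => TensorProduct.dualDistrib ℂ A (B ⊗[ℂ] C)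
      (φ ⊗ₜ TensorProduct.dualDistrib ℂ B C (β b ⊗ₜ γ c)) T)
    (fun φ ψ T => by ext; simp [TensorProduct.add_tmul])
    (fun a φ T => by ext; simp [← TensorProduct.smul_tmul'])
    (fun φ T S => by ext; simp)
    (fun a φ T => by ext; simp)

theorem tensorSlice_tmul (β : κ → Module.Dual ℂ B) (γ : κ' → Module.Dual ℂ C)
    (φ : Module.Dual ℂ A) (x : A) (y : B) (z : C) :
    tensorSlice β γ φ (x ⊗ₜ (y ⊗ₜ z)) =
      φ x • Matrix.vecMulVec (fun b => β b y) (fun c => γ c z) := by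
  ext b c
  simp [tensorSlice, Matrix.vecMulVec_apply]

/-- The coordinates on a tensor product given by products of coordinates on the factors. -/
noncomputable def prodCoord (β : κ → Module.Dual ℂ B) (β' : κ' → Module.Dual ℂ B') :
    κ × κ' → Module.Dual ℂ (B ⊗[ℂ] B') :=
  fun k => TensorProduct.dualDistrib ℂ B B' (β k.1 ⊗ₜ β' k.2)

theorem tensorSlice_kronecker {ι ι' α α' : Type*} (φ : α → Module.Dual ℂ A)
    (φ' : α' → Module.Dual ℂ A')
    (β : κ → Module.Dual ℂ B) (γ : κ' → Module.Dual ℂ C)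
    (β' : ι → Module.Dual ℂ B') (γ' : ι' → Module.Dual ℂ C') (a : α × α')
    (T : A ⊗[ℂ] (B ⊗[ℂ] C)) (S : A' ⊗[ℂ] (B' ⊗[ℂ] C')) :
    tensorSlice (prodCoord β β') (prodCoord γ γ') (prodCoord φ φ' a) (kronecker T S) =
      tensorSlice β γ (φ a.1) T ⊗ₖ tensorSlice β' γ' (φ' a.2) S := by
  obtain ⟨r, x, y, z, rfl⟩ := exists_isSumOfSimple T
  obtain ⟨r', x', y', z', rfl⟩ := exists_isSumOfSimple S
  rw [kronecker_sum_sum]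
  ext ⟨b, b'⟩ ⟨c, c'⟩
  simp only [map_sum, kronecker_tmul, tensorSlice_tmul, Matrix.sum_apply, Matrix.smul_apply,
    Matrix.kroneckerMap_apply, Matrix.vecMulVec_apply, prodCoord, TensorProduct.dualDistrib_apply,
    Finset.sum_mul_sum, smul_eq_mul]
  exact Finset.sum_congr rfl fun i _ => Finset.sum_congr rfl fun j _ => by ring

/-- The Koszul flattening of a tensor with respect to five functionals on the first factor. -/
noncomputable def koszulFlattening (β : κ → Module.Dual ℂ B) (γ : κ → Module.Dual ℂ C)
    (φ₀ : Module.Dual ℂ A) (φ : Fin 4 → Module.Dual ℂ A) : A ⊗[ℂ] (B ⊗[ℂ] C) →ₗ[ℂ]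
      Matrix (Fin 6 × κ ⊕ Fin 4 × κ) (Fin 6 × κ ⊕ Fin 4 × κ) ℂ where
  toFun T := koszulBlock (tensorSlice β γ φ₀ T) fun i => tensorSlice β γ (φ i) T
  map_add' T S := by
    simp only [koszulBlock, map_add, Matrix.kronecker_add, Finset.sum_add_distrib,
      Matrix.fromBlocks_add, add_zero]
  map_smul' c T := by
    simp only [koszulBlock, map_smul, Matrix.kronecker_smul, ← Finset.smul_sum,
      Matrix.fromBlocks_smul, smul_zero, RingHom.id_apply]

theorem rank_koszulFlattening_tmul_le [Fintype κ] (β : κ → Module.Dual ℂ B)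
    (γ : κ → Module.Dual ℂ C) (φ₀ : Module.Dual ℂ A) (φ : Fin 4 → Module.Dual ℂ A)
    (x : A) (y : B) (z : C) :
    (koszulFlattening β γ φ₀ φ (x ⊗ₜ (y ⊗ₜ z))).rank ≤ 6 := by
  simp only [koszulFlattening, LinearMap.coe_mk, AddHom.coe_mk, tensorSlice_tmul]
  exact rank_koszulBlock_smul_vecMulVec_le _ _ _ _

theorem isSumOfSimple_tensorRank (T : A ⊗[ℂ] (B ⊗[ℂ] C)) : IsSumOfSimple T (tensorRank T) :=
  Nat.sInf_mem (exists_isSumOfSimple T)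

theorem isLimitOfRankLE_borderRank (T : A ⊗[ℂ] (B ⊗[ℂ] C)) : IsLimitOfRankLE T (borderRank T) :=
  Nat.sInf_mem (exists_isLimitOfRankLE T)

variable {m n : Type*} [Fintype n]

theorem rank_le_tensorRank_mul [Finite m] {Φ : A ⊗[ℂ] (B ⊗[ℂ] C) →ₗ[ℂ] Matrix m n ℂ} {c : ℕ}
    (hΦ : ∀ x y z, (Φ (x ⊗ₜ (y ⊗ₜ z))).rank ≤ c) (T : A ⊗[ℂ] (B ⊗[ℂ] C)) :
    (Φ T).rank ≤ tensorRank T * c := by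
  obtain ⟨x, y, z, hT⟩ := isSumOfSimple_tensorRank T
  calc (Φ T).rank = (∑ l, Φ (x l ⊗ₜ (y l ⊗ₜ z l))).rank := by rw [← map_sum, ← hT]
    _ ≤ (Finset.univ : Finset (Fin (tensorRank T))).card * c :=
      rank_sum_le_card_mul _ _ fun l => hΦ (x l) (y l) (z l)
    _ = tensorRank T * c := by rw [Finset.card_fin]

theorem isOpen_setOf_le_rank [Finite m] (r : ℕ) : IsOpen {M : Matrix m n ℂ | r ≤ M.rank} := by
  classical
  cases nonempty_fintype m
  have hcont : Continuous (Matrix.toLin'.trans LinearMap.toContinuousLinearMap :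
      Matrix m n ℂ ≃ₗ[ℂ] (n → ℂ) →L[ℂ] (m → ℂ)).toLinearMap :=
    LinearMap.continuous_of_finiteDimensional _
  convert (isOpen_setOfPred_nat_le_rank r).preimage hcont using 1
  ext M
  change r ≤ Module.finrank ℂ (LinearMap.range M.mulVecLin) ↔
    (r : Cardinal) ≤ Module.rank ℂ (LinearMap.range M.mulVecLin)
  rw [← Module.finrank_eq_rank, Nat.cast_le]

theorem rank_le_mul_of_isLimitOfRankLE [Finite m] {Φ : A ⊗[ℂ] (B ⊗[ℂ] C) →ₗ[ℂ] Matrix m n ℂ}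
    {c r : ℕ} (hΦ : ∀ x y z, (Φ (x ⊗ₜ (y ⊗ₜ z))).rank ≤ c) {T : A ⊗[ℂ] (B ⊗[ℂ] C)}
    (hT : IsLimitOfRankLE T r) : (Φ T).rank ≤ r * c := by
  obtain ⟨u, hu, hlim⟩ := hT
  let _ : TopologicalSpace (A ⊗[ℂ] (B ⊗[ℂ] C)) := moduleTopology ℂ _
  have : IsModuleTopology ℂ (A ⊗[ℂ] (B ⊗[ℂ] C)) := ⟨rfl⟩
  have hΦT := ((IsModuleTopology.continuous_of_linearMap Φ).tendsto T).comp hlim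
  have hopen := (isOpen_setOf_le_rank (Φ T).rank).mem_nhds (le_refl (Φ T).rank)
  obtain ⟨k, hk⟩ := (hΦT.eventually_mem hopen).exists
  calc (Φ T).rank ≤ (Φ (u k)).rank := hk
    _ ≤ tensorRank (u k) * c := rank_le_tensorRank_mul hΦ (u k)
    _ ≤ r * c := Nat.mul_le_mul_right c (hu k)

end Flattening

section LowerBound

/-- The coordinates on `(ℂ^{q+1})^{⊗3}` indexed by words. -/
noncomputable def wordCoord (q : ℕ) : Word (Fin (q + 1)) →
    Module.Dual ℂ (((Fin (q + 1) → ℂ) ⊗[ℂ] (Fin (q + 1) → ℂ)) ⊗[ℂ] (Fin (q + 1) → ℂ)) :=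
  prodCoord (prodCoord LinearMap.proj LinearMap.proj) LinearMap.proj

theorem tensorSlice_littleCW (q : ℕ) (a : Fin (q + 1)) :
    tensorSlice LinearMap.proj LinearMap.proj (LinearMap.proj a) (littleCW q) =
      letterMatrix ℂ (0 : Fin (q + 1)) * traceForm ℂ (Fin (q + 1)) * (letterMatrix ℂ a)ᵀ := by
  rw [traceForm, Equiv.Perm.permMatrix, PEquiv.mul_toMatrix_toPEquiv]
  ext b c
  simp only [littleCW, map_sum, map_add, tensorSlice_tmul, stdVec, Matrix.sum_apply,
    Matrix.add_apply, Matrix.smul_apply, Matrix.vecMulVec_apply, LinearMap.proj_apply,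
    Pi.single_apply, Matrix.mul_apply, Matrix.submatrix_apply, Matrix.transpose_apply, letterMatrix,
    Matrix.of_apply, id_eq, Equiv.symm_swap, letterMul]
  cases a using Fin.cases <;> cases b using Fin.cases <;> cases c using Fin.cases <;>
    simp [Fintype.sum_option, Equiv.swap_apply_def, eq_comm]

theorem tensorSlice_kroneckerCube_littleCW (q : ℕ) (μ : Word (Fin (q + 1))) :
    tensorSlice (wordCoord q) (wordCoord q) (wordCoord q μ) (kroneckerCube (littleCW q)) =
      wordMatrix ℂ (0 : Word (Fin (q + 1))) * wordTraceForm ℂ (Fin (q + 1)) *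
        (wordMatrix ℂ μ)ᵀ := by
  simp only [wordCoord, kroneckerCube, tensorSlice_kronecker, tensorSlice_littleCW, wordMatrix,
    wordTraceForm, ← Matrix.kroneckerMap_transpose, Matrix.mul_kronecker_mul, Prod.fst_zero,
    Prod.snd_zero]

/-- The functional `fᵢ` on `(ℂ^{q+1})^{⊗3}`, the sum of the coordinates of the words in
`supports i`. -/
noncomputable def supportFunctional (q : ℕ) (g : Fin 6 → Fin (q + 1)) (i : Fin 4) :
    Module.Dual ℂ (((Fin (q + 1) → ℂ) ⊗[ℂ] (Fin (q + 1) → ℂ)) ⊗[ℂ] (Fin (q + 1) → ℂ)) :=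
  ((supports i).map fun μ => wordCoord q (Word.map g μ)).sum

theorem tensorSlice_supportFunctional (q : ℕ) (g : Fin 6 → Fin (q + 1)) (i : Fin 4) :
    tensorSlice (wordCoord q) (wordCoord q) (supportFunctional q g i)
        (kroneckerCube (littleCW q)) =
      wordMatrix ℂ (0 : Word (Fin (q + 1))) * wordTraceForm ℂ (Fin (q + 1)) *
        (supportMatrix ℂ g i)ᵀ := by
  rw [supportFunctional, supportMatrix]
  induction supports i with
  | nil => simp
  | cons μ l ih =>
    simp only [List.map_cons, List.sum_cons, map_add, LinearMap.add_apply, ih,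
      tensorSlice_kroneckerCube_littleCW, Matrix.transpose_add, Matrix.mul_add]

theorem le_of_isLimitOfRankLE_kroneckerCube {q r : ℕ} (hq : 5 ≤ q)
    (h : IsLimitOfRankLE (kroneckerCube (littleCW q)) r) : (q + 2) ^ 3 ≤ r := by
  let g : Fin 6 → Fin (q + 1) := Fin.castLE (by omega)
  have hrank := rank_le_mul_of_isLimitOfRankLE
    (rank_koszulFlattening_tmul_le (wordCoord q) (wordCoord q) (wordCoord q 0)
      (supportFunctional q g)) h
  have hlower := card_le_rank_koszulBlock_supportMatrix (K := ℂ) (g := g)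
    (Fin.castLE_injective _) rfl
  simp only [koszulFlattening, LinearMap.coe_mk, AddHom.coe_mk, tensorSlice_supportFunctional,
    tensorSlice_kroneckerCube_littleCW] at hrank
  rw [Fintype.card_fin] at hlower
  exact Nat.le_of_mul_le_mul_left (hlower.trans (hrank.trans_eq (mul_comm r 6))) (by norm_num)

end LowerBound

section UpperBound

variable {A B C A' B' C' : Type*}
  [AddCommGroup A] [Module ℂ A] [AddCommGroup B] [Module ℂ B] [AddCommGroup C] [Module ℂ C]
  [AddCommGroup A'] [Module ℂ A'] [AddCommGroup B'] [Module ℂ B'] [AddCommGroup C'] [Module ℂ C']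

theorem IsSumOfSimple.add {S T : A ⊗[ℂ] (B ⊗[ℂ] C)} {r s : ℕ} (hS : IsSumOfSimple S r)
    (hT : IsSumOfSimple T s) : IsSumOfSimple (S + T) (r + s) := by
  obtain ⟨x, y, z, rfl⟩ := hS
  obtain ⟨x', y', z', rfl⟩ := hT
  refine ⟨Fin.append x x', Fin.append y y', Fin.append z z', ?_⟩
  simp [Fin.sum_univ_add]

theorem IsSumOfSimple.kronecker {T : A ⊗[ℂ] (B ⊗[ℂ] C)} {S : A' ⊗[ℂ] (B' ⊗[ℂ] C')} {r s : ℕ}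
    (hT : IsSumOfSimple T r) (hS : IsSumOfSimple S s) : IsSumOfSimple (kronecker T S) (r * s) := by
  obtain ⟨x, y, z, rfl⟩ := hT
  obtain ⟨x', y', z', rfl⟩ := hS
  refine ⟨fun l => x (finProdFinEquiv.symm l).1 ⊗ₜ x' (finProdFinEquiv.symm l).2,
    fun l => y (finProdFinEquiv.symm l).1 ⊗ₜ y' (finProdFinEquiv.symm l).2,
    fun l => z (finProdFinEquiv.symm l).1 ⊗ₜ z' (finProdFinEquiv.symm l).2, ?_⟩
  rw [kronecker_sum_sum, ← Fintype.sum_prod_type', ← finProdFinEquiv.symm.sum_comp]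
  simp only [kronecker_tmul]

theorem tensorRank_kronecker_le (T : A ⊗[ℂ] (B ⊗[ℂ] C)) (S : A' ⊗[ℂ] (B' ⊗[ℂ] C')) :
    tensorRank (kronecker T S) ≤ tensorRank T * tensorRank S :=
  Nat.sInf_le ((isSumOfSimple_tensorRank T).kronecker (isSumOfSimple_tensorRank S))

theorem tendsto_bilinear_moduleTopology [Module.Finite ℂ A] (f : A →ₗ[ℂ] B →ₗ[ℂ] C)
    {ι : Type*} {l : Filter ι} {u : ι → A} {v : ι → B} {a : A} {b : B}
    (hu : Filter.Tendsto u l (@nhds _ (moduleTopology ℂ A) a))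
    (hv : Filter.Tendsto v l (@nhds _ (moduleTopology ℂ B) b)) :
    Filter.Tendsto (fun n => f (u n) (v n)) l (@nhds _ (moduleTopology ℂ C) (f a b)) := by
  let _ : TopologicalSpace A := moduleTopology ℂ A
  let _ : TopologicalSpace B := moduleTopology ℂ B
  let _ : TopologicalSpace C := moduleTopology ℂ C
  have : IsModuleTopology ℂ A := ⟨rfl⟩
  have : IsModuleTopology ℂ B := ⟨rfl⟩
  have : IsModuleTopology ℂ C := ⟨rfl⟩
  have h := (IsModuleTopology.continuous_bilinear_of_finite_left f).tendsto (a, b)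
  exact h.comp (hu.prodMk_nhds hv)

theorem IsLimitOfRankLE.kronecker [Module.Finite ℂ A] [Module.Finite ℂ B] [Module.Finite ℂ C]
    {T : A ⊗[ℂ] (B ⊗[ℂ] C)} {S : A' ⊗[ℂ] (B' ⊗[ℂ] C')} {r s : ℕ}
    (hT : IsLimitOfRankLE T r) (hS : IsLimitOfRankLE S s) :
    IsLimitOfRankLE (kronecker T S) (r * s) := by
  obtain ⟨u, hur, hu⟩ := hT
  obtain ⟨v, hvs, hv⟩ := hS
  exact ⟨fun n => _root_.kronecker (u n) (v n),
    fun n => (tensorRank_kronecker_le _ _).trans (Nat.mul_le_mul (hur n) (hvs n)),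
    tendsto_bilinear_moduleTopology kroneckerBilinear hu hv⟩

theorem isLimitOfRankLE_of_degeneration {T : A ⊗[ℂ] (B ⊗[ℂ] C)} {d r : ℕ}
    (X : Fin d → A ⊗[ℂ] (B ⊗[ℂ] C))
    (h : ∀ ε : ℂ, ε ≠ 0 → tensorRank (T + ∑ i : Fin d, ε ^ (i + 1 : ℕ) • X i) ≤ r) :
    IsLimitOfRankLE T r := by
  refine ⟨fun n => T + ∑ i : Fin d, (1 / ((n : ℂ) + 1)) ^ (i + 1 : ℕ) • X i,
    fun n => h _ (one_div_ne_zero (Nat.cast_add_one_ne_zero n)), ?_⟩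
  let _ : TopologicalSpace (A ⊗[ℂ] (B ⊗[ℂ] C)) := moduleTopology ℂ _
  have : IsModuleTopology ℂ (A ⊗[ℂ] (B ⊗[ℂ] C)) := ⟨rfl⟩
  have : IsTopologicalAddGroup (A ⊗[ℂ] (B ⊗[ℂ] C)) := IsModuleTopology.topologicalAddGroup ℂ _
  have : ContinuousSMul ℂ (A ⊗[ℂ] (B ⊗[ℂ] C)) := IsModuleTopology.toContinuousSMul ℂ _
  have hcurve : Continuous fun ε : ℂ => T + ∑ i : Fin d, ε ^ (i + 1 : ℕ) • X i := by fun_prop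
  have hlim := hcurve.tendsto 0
  simp only [zero_pow (Nat.succ_ne_zero _), zero_smul, Finset.sum_const_zero, add_zero] at hlim
  exact hlim.comp tendsto_one_div_add_atTop_nhds_zero_nat

/-- The tensor `x ⊗ x ⊗ x`. -/
noncomputable def tensorCube (x : A) : A ⊗[ℂ] (A ⊗[ℂ] A) := x ⊗ₜ (x ⊗ₜ x)

/-- The symmetric tensor `x ⊗ x ⊗ y + x ⊗ y ⊗ x + y ⊗ x ⊗ x`, the derivative of `tensorCube` at `x`
in the direction `y`. -/
noncomputable def polarization (x : A) : A →ₗ[ℂ] A ⊗[ℂ] (A ⊗[ℂ] A) where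
  toFun y := x ⊗ₜ (x ⊗ₜ y) + x ⊗ₜ (y ⊗ₜ x) + y ⊗ₜ (x ⊗ₜ x)
  map_add' y z := by
    simp only [TensorProduct.tmul_add, TensorProduct.add_tmul]
    abel
  map_smul' c y := by
    simp only [TensorProduct.tmul_smul, ← TensorProduct.smul_tmul', smul_add, RingHom.id_apply]

theorem tensorCube_add_smul (x y : A) (c : ℂ) : tensorCube (x + c • y) =
    tensorCube x + c • polarization x y + c ^ 2 • polarization y x + c ^ 3 • tensorCube y := by
  simp only [tensorCube, polarization, LinearMap.coe_mk, AddHom.coe_mk, TensorProduct.tmul_add,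
    TensorProduct.add_tmul, TensorProduct.tmul_smul, ← TensorProduct.smul_tmul', smul_add,
    smul_smul]
  module

theorem isSumOfSimple_sum_smul_tensorCube {n : ℕ} (c : Fin n → ℂ) (x : Fin n → A) :
    IsSumOfSimple (∑ j, c j • tensorCube (x j)) n :=
  ⟨fun j => c j • x j, x, x, by simp only [tensorCube, TensorProduct.smul_tmul']⟩

theorem sum_polarization_add_smul_sub_smul {n : ℕ} (x : A) (e : Fin n → A) {ε : ℂ} (hε : ε ≠ 0) :
    ∑ j, polarization (e j) x + ε • (∑ j, tensorCube (e j) - polarization (∑ j, e j) x) -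
        ε ^ 3 • tensorCube (∑ j, e j) =
      ∑ j, (ε ^ 2)⁻¹ • tensorCube (x + ε • e j) +
        ((ε ^ 3)⁻¹ - n * (ε ^ 2)⁻¹) • tensorCube x -
          (ε ^ 3)⁻¹ • tensorCube (x + ε ^ 2 • ∑ j, e j) := by
  simp only [tensorCube_add_smul, Finset.sum_add_distrib, smul_add, map_sum, ← Finset.smul_sum,
    Finset.sum_const, Finset.card_univ, Fintype.card_fin, ← Nat.cast_smul_eq_nsmul ℂ, smul_smul,
    smul_sub]
  match_scalars <;> field_simp <;> ring

theorem isSumOfSimple_sum_polarization_add_smul_sub_smul {n : ℕ} (x : A) (e : Fin n → A) {ε : ℂ}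
    (hε : ε ≠ 0) :
    IsSumOfSimple (∑ j, polarization (e j) x +
      ε • (∑ j, tensorCube (e j) - polarization (∑ j, e j) x) -
        ε ^ 3 • tensorCube (∑ j, e j)) (n + 2) := by
  rw [sum_polarization_add_smul_sub_smul x e hε, add_sub_assoc, sub_eq_add_neg, ← neg_smul]
  have h := isSumOfSimple_sum_smul_tensorCube ![(ε ^ 3)⁻¹ - n * (ε ^ 2)⁻¹, -(ε ^ 3)⁻¹]
    ![x, x + ε ^ 2 • ∑ j, e j]
  rw [Fin.sum_univ_two] at h
  exact (isSumOfSimple_sum_smul_tensorCube _ _).add h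

theorem isLimitOfRankLE_sum_polarization {n : ℕ} (x : A) (e : Fin n → A) :
    IsLimitOfRankLE (∑ j, polarization (e j) x) (n + 2) := by
  refine isLimitOfRankLE_of_degeneration
    ![∑ j, tensorCube (e j) - polarization (∑ j, e j) x, 0, -tensorCube (∑ j, e j)]
    fun ε hε => Nat.sInf_le ?_
  simpa [Fin.sum_univ_three, sub_eq_add_neg, add_assoc] using
    isSumOfSimple_sum_polarization_add_smul_sub_smul x e hε

theorem isLimitOfRankLE_littleCW (q : ℕ) : IsLimitOfRankLE (littleCW q) (q + 2) := by
  have h : littleCW q = ∑ j : Fin q, polarization (stdVec q j.succ) (stdVec q 0) := by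
    refine Finset.sum_congr rfl fun j _ => ?_
    simp only [polarization, LinearMap.coe_mk, AddHom.coe_mk]
    abel
  rw [h]
  exact isLimitOfRankLE_sum_polarization _ _

end UpperBound

theorem theorem4p1 (q : ℕ) (hq : 5 ≤ q) :
    borderRank (kroneckerCube (littleCW q)) = (q + 2) ^ 3 := by
  have hT := isLimitOfRankLE_littleCW q
  refine le_antisymm (Nat.sInf_le ?_)
    (le_of_isLimitOfRankLE_kroneckerCube hq (isLimitOfRankLE_borderRank _))
  rw [pow_succ, sq]
  exact (hT.kronecker hT).kronecker hT
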